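/- For a positive integer $n$, let $\mathcal{P}_n$ be the family of all sets of $n$ points in the Euclidean plane such that the distance between any two points of the set is at most $1$. For $0 < r \le 1$, let $N_n(r)$ be the largest integer $k$ such that for every point set $P \in \mathcal{P}_n$ there is a closed circular disc of radius $r$ which covers at least $k$ points of $P$. Then for every positive integer $n$, $$\left\lceil \frac{n}{3} \right\rceil \le N_n\!\left(\frac12\right) \le \left\lceil \frac{n}{3} \right\rceil + 1 .$$ -/

import Mathlib

namespace FractionalJung

/-- The Euclidean plane. -/
abbrev Plane : Type := EuclideanSpace ℝ (Fin 2)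

/-- The family of all sets of `n` (distinct) points of the plane in which the distance between any
two points is at most `1`. -/
def pointSets (n : ℕ) : Set (Finset Plane) :=
  {P | P.card = n ∧ ∀ x ∈ P, ∀ y ∈ P, dist x y ≤ 1}

/-- The integers `k` such that for every point set `P` in `pointSets n` some closed circular disc
of radius `r` covers at least `k` points of `P`. -/
def guaranteed (n : ℕ) (r : ℝ) : Set ℕ :=
  {k | ∀ P ∈ pointSets n, ∃ c : Plane, k ≤ ((P : Set Plane) ∩ Metric.closedBall c r).ncard}

/-- `N n r` is the largest element of `guaranteed n r`; it exists by `isGreatest_N`. -/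
noncomputable def N (n : ℕ) (r : ℝ) : ℕ := sSup (guaranteed n r)

theorem pointSets_nonempty (n : ℕ) : (pointSets n).Nonempty := by
  have hinf : (Metric.ball (0 : Plane) (1 / 2)).Infinite :=
    infinite_of_mem_nhds (0 : Plane) (Metric.ball_mem_nhds _ (by norm_num))
  obtain ⟨P, hP, hcard⟩ := hinf.exists_subset_card_eq n
  refine ⟨P, hcard, fun x hx y hy => ?_⟩
  have h1 := Metric.mem_ball.1 (hP hx)
  have h2 := Metric.mem_ball.1 (hP hy)
  have h3 := dist_triangle_right x y (0 : Plane)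
  linarith

/-- The supremum defining `N n r` is a maximum. -/
theorem isGreatest_N (n : ℕ) (r : ℝ) : IsGreatest (guaranteed n r) (N n r) := by
  have hne : (guaranteed n r).Nonempty := ⟨0, fun _ _ => ⟨0, Nat.zero_le _⟩⟩
  have hbdd : BddAbove (guaranteed n r) := by
    refine ⟨n, fun k hk => ?_⟩
    obtain ⟨P, hP⟩ := pointSets_nonempty n
    obtain ⟨c, hc⟩ := hk P hP
    calc k ≤ ((P : Set Plane) ∩ Metric.closedBall c r).ncard := hc
      _ ≤ (P : Set Plane).ncard := Set.ncard_le_ncard Set.inter_subset_left P.finite_toSet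
      _ = n := by rw [Set.ncard_coe_finset, hP.1]
  exact ⟨Nat.sSup_mem hne hbdd, fun k hk => le_csSup hbdd hk⟩

end FractionalJung

/-! Lower bound: by Jung's theorem (Helly plus the case of triangles) the set lies in a disc of
radius `1 / √3`. Three discs of radius `1 / 2` cover it, and one of them takes a third of the
points. Upper bound: put `m = ⌈n / 3⌉` candidate points near each vertex of a unit equilateral
triangle, each cluster on the unit circle about the preceding vertex, with heights shrinking faster
than by squaring. A disc of radius `1 / 2` misses some cluster (`not_meets_three`). If it holds two
points of one cluster and one of the preceding cluster, the latter forms a near-diameter with each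
of the two. This bounds its index (`le_of_mem_closedBall`), so two clusters contribute at most `m +
1` points. -/

namespace FractionalJung

/-! ### Circumradius of triangles and near-diameters of balls. -/

section InnerProduct

variable {E : Type*} [NormedAddCommGroup E] [InnerProductSpace ℝ E]

/-- Jung's theorem for a triangle with one vertex at the origin. -/
theorem exists_norm_sq_le_third {u v : E} (hu : ‖u‖ ^ 2 ≤ 1) (hv : ‖v‖ ^ 2 ≤ 1)
    (huv : ‖u - v‖ ^ 2 ≤ 1) :
    ∃ c : E, ‖c‖ ^ 2 ≤ 1 / 3 ∧ ‖u - c‖ ^ 2 ≤ 1 / 3 ∧ ‖v - c‖ ^ 2 ≤ 1 / 3 := by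
  have key : ∀ a b : ℝ, ‖a • u + b • v‖ ^ 2
      = a ^ 2 * ‖u‖ ^ 2 + 2 * (a * b) * inner ℝ u v + b ^ 2 * ‖v‖ ^ 2 := by
    intro a b
    rw [norm_add_sq_real, norm_smul, norm_smul, real_inner_smul_left, real_inner_smul_right,
      mul_pow, mul_pow, Real.norm_eq_abs, Real.norm_eq_abs, sq_abs, sq_abs]
    ring
  have hs : ‖u - v‖ ^ 2 = ‖u‖ ^ 2 - 2 * inner ℝ u v + ‖v‖ ^ 2 := norm_sub_sq_real u v
  rw [hs] at huv
  have hp : 0 ≤ ‖u‖ ^ 2 := by positivity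
  have hq : 0 ≤ ‖v‖ ^ 2 := by positivity
  suffices h : ∃ a b : ℝ, ‖a • u + b • v‖ ^ 2 ≤ 1 / 3 ∧ ‖(1 - a) • u + (-b) • v‖ ^ 2 ≤ 1 / 3 ∧
      ‖(-a) • u + (1 - b) • v‖ ^ 2 ≤ 1 / 3 by
    obtain ⟨a, b, h₁, h₂, h₃⟩ := h
    refine ⟨a • u + b • v, h₁, ?_, ?_⟩
    · convert h₂ using 3
      module
    · convert h₃ using 3
      module
  simp only [key]
  generalize ‖u‖ ^ 2 = p at *
  generalize ‖v‖ ^ 2 = q at *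
  generalize (inner ℝ u v : ℝ) = r at *
  -- `r`, `p - r`, `q - r` are the inner products of the sides at the three vertices. If one is
  -- nonpositive, the midpoint of the opposite side serves as centre.
  rcases le_or_gt r 0 with hr | hr
  · exact ⟨1 / 2, 1 / 2, by linarith, by linarith, by linarith⟩
  rcases le_or_gt p r with hpr | hpr
  · exact ⟨0, 1 / 2, by linarith, by linarith, by linarith⟩
  rcases le_or_gt q r with hqr | hqr
  · exact ⟨1 / 2, 0, by linarith, by linarith, by linarith⟩
  have hD : 0 < 2 * (p * q - r ^ 2) := by nlinarith
  -- Coordinates of the circumcentre, the solution of `e₁` and `e₂`; acuteness makes the barycentric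
  -- weights `a`, `b`, `1 - a - b` nonnegative.
  obtain ⟨a, ha⟩ : ∃ a, a = q * (p - r) / (2 * (p * q - r ^ 2)) := ⟨_, rfl⟩
  obtain ⟨b, hb⟩ : ∃ b, b = p * (q - r) / (2 * (p * q - r ^ 2)) := ⟨_, rfl⟩
  have ha0 : 0 ≤ a := by
    rw [ha]; exact div_nonneg (mul_nonneg hq (by linarith)) hD.le
  have hb0 : 0 ≤ b := by
    rw [hb]; exact div_nonneg (mul_nonneg hp (by linarith)) hD.le
  rw [eq_div_iff hD.ne'] at ha hb
  have hc : 0 ≤ 1 - a - b := by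
    refine nonneg_of_mul_nonneg_left ?_ hD
    have : (1 - a - b) * (2 * (p * q - r ^ 2)) = r * (p + q - 2 * r) := by
      linear_combination -ha - hb
    rw [this]; exact mul_nonneg hr.le (by linarith)
  have e₁ : a * p + b * r = p / 2 :=
    mul_right_cancel₀ hD.ne' (by linear_combination p * ha + r * hb)
  have e₂ : a * r + b * q = q / 2 :=
    mul_right_cancel₀ hD.ne' (by linear_combination r * ha + q * hb)
  have hR : a ^ 2 * p + 2 * (a * b) * r + b ^ 2 * q = a * p / 2 + b * q / 2 := by
    linear_combination a * e₁ + b * e₂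
  have hV : a * p / 2 + b * q / 2
      = a * (1 - a - b) * p + b * (1 - a - b) * q + a * b * (p - 2 * r + q) := by
    linear_combination hR
  -- Squared sides are at most `1`, and the pairwise products of three weights with sum `1` add up
  -- to at most `1 / 3`.
  have hR3 : a * p / 2 + b * q / 2 ≤ 1 / 3 := by
    rw [hV]
    have h₁ := mul_le_of_le_one_right (mul_nonneg ha0 hc) hu
    have h₂ := mul_le_of_le_one_right (mul_nonneg hb0 hc) hv
    have h₃ := mul_le_of_le_one_right (mul_nonneg ha0 hb0) huv
    nlinarith [sq_nonneg (a - b), sq_nonneg (a - (1 - a - b)), sq_nonneg (b - (1 - a - b))]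
  exact ⟨a, b, by linarith, by nlinarith, by nlinarith⟩

theorem exists_dist_sq_le_third {x y z : E} (hxy : dist x y ≤ 1) (hxz : dist x z ≤ 1)
    (hyz : dist y z ≤ 1) :
    ∃ o : E, dist o x ^ 2 ≤ 1 / 3 ∧ dist o y ^ 2 ≤ 1 / 3 ∧ dist o z ^ 2 ≤ 1 / 3 := by
  obtain ⟨c, h₁, h₂, h₃⟩ := exists_norm_sq_le_third (u := x - z) (v := y - z)
    (by rw [← dist_eq_norm]; exact pow_le_one₀ dist_nonneg hxz)
    (by rw [← dist_eq_norm]; exact pow_le_one₀ dist_nonneg hyz)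
    (by rw [sub_sub_sub_cancel_right, ← dist_eq_norm]; exact pow_le_one₀ dist_nonneg hxy)
  refine ⟨z + c, ?_, ?_, ?_⟩
  · rwa [dist_comm, dist_eq_norm, ← sub_sub]
  · rwa [dist_comm, dist_eq_norm, ← sub_sub]
  · rwa [dist_eq_norm, add_sub_cancel_left]

/-- Two points of a ball of radius `1 / 2` that are at distance one from `w` are close to each
other if the ball contains a point close to `w`. -/
theorem dist_sq_le_of_mem_closedBall {o a b c w : E} (ha : dist a o ≤ 1 / 2)
    (hb : dist b o ≤ 1 / 2) (hc : dist c o ≤ 1 / 2) (haw : dist a w = 1) (hbw : dist b w = 1) :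
    dist a b ^ 2 ≤ 8 * dist c w := by
  -- As `a` and `c` are almost at distance `1`, the parallelogram law puts their midpoint near `o`.
  -- So `a`, and likewise `b`, is almost the reflection of `c` in `o`.
  have median : ∀ a : E, dist a o ≤ 1 / 2 → dist a w = 1 →
      ‖(a + c) - (o + o)‖ ^ 2 ≤ 2 * dist c w := by
    intro a ha haw
    have hp := parallelogram_law_with_norm ℝ (a - o) (c - o)
    have h₁ : a - o + (c - o) = (a + c) - (o + o) := by abel
    rw [h₁, sub_sub_sub_cancel_right, ← dist_eq_norm a, ← dist_eq_norm c, ← dist_eq_norm a] at hp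
    have h₂ : 1 - dist c w ≤ dist a c := by
      have := dist_triangle a c w
      linarith
    have h₃ : 1 - 2 * dist c w ≤ dist a c ^ 2 := by
      have h0 : 0 ≤ dist a c := dist_nonneg
      nlinarith [sq_nonneg (dist a c - 1)]
    nlinarith [@dist_nonneg _ _ a o, @dist_nonneg _ _ c o]
  have h₁ := median a ha haw
  have h₂ := median b hb hbw
  have h₃ : dist a b ≤ ‖(a + c) - (o + o)‖ + ‖(b + c) - (o + o)‖ := by
    have e : a - b = ((a + c) - (o + o)) - ((b + c) - (o + o)) := by abel
    rw [dist_eq_norm, e]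
    exact norm_sub_le _ _
  have h₄ : dist a b ^ 2 ≤ (‖(a + c) - (o + o)‖ + ‖(b + c) - (o + o)‖) ^ 2 := by gcongr
  nlinarith [sq_nonneg (‖(a + c) - (o + o)‖ - ‖(b + c) - (o + o)‖)]

end InnerProduct

/-! ### Lower bound: Jung's theorem and a cover by three discs. -/

/-- **Jung's theorem** for finite sets in the plane. -/
theorem exists_subset_closedBall_of_dist_le_one {P : Finset Plane}
    (hP : ∀ x ∈ P, ∀ y ∈ P, dist x y ≤ 1) : ∃ o : Plane, ∀ x ∈ P, dist o x ^ 2 ≤ 1 / 3 := by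
  have hball : ∀ o x : Plane, o ∈ Metric.closedBall x (√(1 / 3)) ↔ dist o x ^ 2 ≤ 1 / 3 := by
    intro o x
    rw [Metric.mem_closedBall, Real.le_sqrt dist_nonneg (by norm_num)]
  have hinter : (⋂ x ∈ P, Metric.closedBall x (√(1 / 3))).Nonempty := by
    refine Convex.helly_theorem' (𝕜 := ℝ) (fun x _ => convex_closedBall x _) fun I hI hcard => ?_
    rw [finrank_euclideanSpace_fin] at hcard
    have htriple : ∃ x y z : Plane, dist x y ≤ 1 ∧ dist x z ≤ 1 ∧ dist y z ≤ 1 ∧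
        ∀ p ∈ I, p = x ∨ p = y ∨ p = z := by
      have hd : ∀ x ∈ I, ∀ y ∈ I, dist x y ≤ 1 := fun x hx y hy => hP x (hI hx) y (hI hy)
      interval_cases h : I.card
      · exact ⟨0, 0, 0, by simp, by simp, by simp, by simp [Finset.card_eq_zero.1 h]⟩
      · obtain ⟨x, rfl⟩ := Finset.card_eq_one.1 h
        exact ⟨x, x, x, by simp, by simp, by simp, by simp⟩
      · obtain ⟨x, y, -, rfl⟩ := Finset.card_eq_two.1 h
        exact ⟨x, y, y, hd _ (by simp) _ (by simp), hd _ (by simp) _ (by simp), by simp, by simp⟩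
      · obtain ⟨x, y, z, -, -, -, rfl⟩ := Finset.card_eq_three.1 h
        exact ⟨x, y, z, hd _ (by simp) _ (by simp), hd _ (by simp) _ (by simp),
          hd _ (by simp) _ (by simp), by simp⟩
    obtain ⟨x, y, z, hxy, hxz, hyz, hI'⟩ := htriple
    obtain ⟨o, h₁, h₂, h₃⟩ := exists_dist_sq_le_third hxy hxz hyz
    refine ⟨o, Set.mem_iInter₂.2 fun p hp => (hball o p).2 ?_⟩
    rcases hI' p hp with rfl | rfl | rfl <;> assumption
  obtain ⟨o, ho⟩ := hinter
  exact ⟨o, fun x hx => (hball o x).1 (Set.mem_iInter₂.1 ho x hx)⟩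

theorem dist_le_half_iff (x : Plane) (s t : ℝ) :
    dist x !₂[s, t] ≤ 1 / 2 ↔ (x 0 - s) ^ 2 + (x 1 - t) ^ 2 ≤ 1 / 4 := by
  rw [EuclideanSpace.dist_eq, Real.sqrt_le_left (by norm_num), Fin.sum_univ_two, Real.dist_eq,
    Real.dist_eq, sq_abs, sq_abs]
  norm_num

/-- Three discs of radius `1 / 2` cover a disc of radius `1 / √3`. -/
theorem exists_three_centres (o : Plane) : ∃ c : Fin 3 → Plane, ∀ x : Plane,
    dist o x ^ 2 ≤ 1 / 3 → ∃ k, dist x (c k) ≤ 1 / 2 := by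
  obtain ⟨τ, hτ, hτ0⟩ : ∃ τ : ℝ, τ ^ 2 = 3 ∧ 0 < τ := ⟨√3, by norm_num, by positivity⟩
  -- The midpoints of the sides of the inscribed unit triangle; each disc covers the sector of 120
  -- degrees around its own direction.
  refine ⟨![!₂[o 0 + τ / 6, o 1], !₂[o 0 - τ / 12, o 1 + 1 / 4],
    !₂[o 0 - τ / 12, o 1 - 1 / 4]], fun x hx => ?_⟩
  rw [EuclideanSpace.dist_eq, Real.sq_sqrt (by positivity), Fin.sum_univ_two, Real.dist_eq,
    Real.dist_eq, sq_abs, sq_abs] at hx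
  obtain ⟨a, ha⟩ : ∃ a, a = x 0 - o 0 := ⟨_, rfl⟩
  obtain ⟨b, hb⟩ : ∃ b, b = x 1 - o 1 := ⟨_, rfl⟩
  have hab : a ^ 2 + b ^ 2 ≤ 1 / 3 := by rw [ha, hb]; linarith
  obtain ⟨N, hN, hN0⟩ : ∃ N : ℝ, N ^ 2 = a ^ 2 + b ^ 2 ∧ 0 ≤ N :=
    ⟨√(a ^ 2 + b ^ 2), Real.sq_sqrt (by positivity), by positivity⟩
  have hNτ : N * τ ≤ 1 := by
    refine abs_le_of_sq_le_sq' ?_ zero_le_one |>.2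
    rw [mul_pow, hτ, hN]
    linarith
  have hfin : N ^ 2 + 1 / 12 - N * τ / 6 ≤ 1 / 4 := by
    have : (1 - N * τ) * (1 + N * τ / 2) ≥ 0 :=
      mul_nonneg (by linarith) (by positivity)
    nlinarith
  rcases le_or_gt N (2 * a) with h | h
  · refine ⟨0, ?_⟩
    change dist x !₂[_, _] ≤ _
    rw [dist_le_half_iff]
    have e : (x 0 - (o 0 + τ / 6)) ^ 2 + (x 1 - o 1) ^ 2 = N ^ 2 + 1 / 12 - 2 * a * τ / 6 := by
      rw [hN, ha, hb]; linear_combination hτ / 36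
    rw [e]
    nlinarith
  · have haN : -N ≤ a := by
      refine (abs_le_of_sq_le_sq' ?_ hN0).1
      nlinarith
    -- From `3 * (N ^ 2 - a ^ 2) - (N + a) ^ 2 = 2 * (N + a) * (N - 2 * a)`.
    have hb' : N + a ≤ τ * |b| := by
      refine (abs_le_of_sq_le_sq' ?_ (by positivity)).2
      rw [mul_pow, sq_abs, hτ]
      nlinarith
    have hb'' : τ * N + τ * a ≤ 3 * |b| := by nlinarith [abs_nonneg b]
    rcases le_total 0 b with h0 | h0
    · rw [abs_of_nonneg h0] at hb''
      refine ⟨1, ?_⟩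
      change dist x !₂[_, _] ≤ _
      rw [dist_le_half_iff]
      have e : (x 0 - (o 0 - τ / 12)) ^ 2 + (x 1 - (o 1 + 1 / 4)) ^ 2
          = N ^ 2 + 1 / 12 + a * τ / 6 - b / 2 := by
        rw [hN, ha, hb]; linear_combination hτ / 144
      rw [e]
      nlinarith
    · rw [abs_of_nonpos h0] at hb''
      refine ⟨2, ?_⟩
      change dist x !₂[_, _] ≤ _
      rw [dist_le_half_iff]
      have e : (x 0 - (o 0 - τ / 12)) ^ 2 + (x 1 - (o 1 - 1 / 4)) ^ 2
          = N ^ 2 + 1 / 12 + a * τ / 6 + b / 2 := by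
        rw [hN, ha, hb]; linear_combination hτ / 144
      rw [e]
      nlinarith

theorem ceil_third_mem_guaranteed (n : ℕ) : ⌈(n : ℝ) / 3⌉₊ ∈ guaranteed n (1 / 2) := by
  classical
  rintro P ⟨hcard, hP⟩
  obtain ⟨o, ho⟩ := exists_subset_closedBall_of_dist_le_one hP
  obtain ⟨c, hc⟩ := exists_three_centres o
  let Q : Fin 3 → Finset Plane := fun k => P.filter fun x => dist x (c k) ≤ 1 / 2
  have hsub : P ⊆ Finset.univ.biUnion Q := by
    intro x hx
    obtain ⟨k, hk⟩ := hc x (ho x hx)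
    exact Finset.mem_biUnion.2 ⟨k, Finset.mem_univ k, Finset.mem_filter.2 ⟨hx, hk⟩⟩
  have hsum : n ≤ ∑ k, (Q k).card :=
    hcard ▸ (Finset.card_le_card hsub).trans Finset.card_biUnion_le
  obtain ⟨k, -, hk⟩ : ∃ k ∈ Finset.univ, (n : ℝ) / 3 ≤ ((Q k).card : ℝ) := by
    refine Finset.exists_le_of_sum_le Finset.univ_nonempty ?_
    have : (n : ℝ) ≤ ∑ k, ((Q k).card : ℝ) := mod_cast hsum
    simpa [mul_div_cancel₀] using this
  refine ⟨c k, ?_⟩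
  have hQ : (P : Set Plane) ∩ Metric.closedBall (c k) (1 / 2) = (Q k : Set Plane) := by
    ext x
    simp [Q, Metric.mem_closedBall]
  rw [hQ, Set.ncard_coe_finset]
  exact Nat.ceil_le.2 hk

/-! ### Upper bound: one cluster on a unit arc. -/

/-- A sequence of heights that decreases faster than by squaring. -/
noncomputable def height : ℕ → ℝ
  | 0 => 1 / 100
  | k + 1 => height k ^ 2 / 100

theorem height_pos_and_le (k : ℕ) : 0 < height k ∧ height k ≤ 1 / 100 := by
  induction k with
  | zero => norm_num [height]
  | succ k ih =>
    obtain ⟨h₁, h₂⟩ := ih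
    rw [height]
    exact ⟨by positivity, by nlinarith⟩

theorem height_le_of_lt {k l : ℕ} (h : k < l) : height l ≤ height k ^ 2 / 100 := by
  induction l, h using Nat.le_induction with
  | base => rw [height]
  | succ l _ ih =>
    obtain ⟨h₁, h₂⟩ := height_pos_and_le l
    rw [height]
    nlinarith

/-- The point of the unit circle in the first quadrant at height `height i`. -/
noncomputable def arcPoint (i : ℕ) : ℂ := ⟨√(1 - height i ^ 2), height i⟩

theorem arcPoint_re_sq (i : ℕ) : (arcPoint i).re ^ 2 = 1 - height i ^ 2 := by
  obtain ⟨h₁, h₂⟩ := height_pos_and_le i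
  exact Real.sq_sqrt (by nlinarith)

theorem arcPoint_re_nonneg (i : ℕ) : 0 ≤ (arcPoint i).re := Real.sqrt_nonneg _

theorem arcPoint_re_le_one (i : ℕ) : (arcPoint i).re ≤ 1 := by
  nlinarith [arcPoint_re_sq i, arcPoint_re_nonneg i, sq_nonneg (height i)]

theorem one_sub_arcPoint_re_le (i : ℕ) : 1 - (arcPoint i).re ≤ height i ^ 2 := by
  nlinarith [arcPoint_re_sq i, arcPoint_re_nonneg i, arcPoint_re_le_one i]

theorem norm_sq_eq (z : ℂ) : ‖z‖ ^ 2 = z.re ^ 2 + z.im ^ 2 := by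
  rw [Complex.sq_norm, Complex.normSq_apply]
  ring

theorem norm_arcPoint (i : ℕ) : ‖arcPoint i‖ = 1 := by
  have h : ‖arcPoint i‖ ^ 2 = 1 := by
    rw [norm_sq_eq, arcPoint_re_sq]
    change 1 - height i ^ 2 + height i ^ 2 = 1
    ring
  exact (pow_eq_one_iff_of_nonneg (norm_nonneg _) two_ne_zero).1 h

theorem dist_arcPoint_one_le (i : ℕ) : dist (arcPoint i) 1 ≤ 2 * height i := by
  obtain ⟨h₁, -⟩ := height_pos_and_le i
  refine (abs_le_of_sq_le_sq' ?_ (by positivity)).2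
  rw [dist_eq_norm, norm_sq_eq, Complex.sub_re, Complex.sub_im, Complex.one_re, Complex.one_im]
  change _ + (height i - 0) ^ 2 ≤ _
  nlinarith [arcPoint_re_sq i, one_sub_arcPoint_re_le i]

theorem sq_height_sub_le (i j : ℕ) :
    (height i - height j) ^ 2 ≤ dist (arcPoint i) (arcPoint j) ^ 2 := by
  rw [dist_eq_norm, norm_sq_eq, Complex.sub_re, Complex.sub_im]
  exact le_add_of_nonneg_left (sq_nonneg _)

/-- The height gap alone is at least `height i / 2`, while `height l ≤ height i ^ 2 / 100`. The
factor 16 is the 8 of `dist_sq_le_of_mem_closedBall` times the 2 of `dist_arcPoint_one_le`. -/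
theorem dist_arcPoint_sq_gt {i j l : ℕ} (hij : i < j) (hil : i < l) :
    16 * height l < dist (arcPoint i) (arcPoint j) ^ 2 := by
  refine lt_of_lt_of_le ?_ (sq_height_sub_le i j)
  obtain ⟨h₁, h₂⟩ := height_pos_and_le i
  have h₃ := height_le_of_lt hij
  have h₄ := height_le_of_lt hil
  have h₅ : height i / 2 ≤ height i - height j := by nlinarith
  have h₆ : (height i / 2) ^ 2 ≤ (height i - height j) ^ 2 := by gcongr
  nlinarith [sq_pos_of_pos h₁]

theorem arcPoint_injective : Function.Injective arcPoint := by
  have key : ∀ i j, i < j → arcPoint i ≠ arcPoint j := by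
    intro i j hij h
    have := dist_arcPoint_sq_gt hij (Nat.lt_succ_self i)
    rw [h, dist_self] at this
    linarith [(height_pos_and_le (i + 1)).1]
  intro i j h
  rcases lt_trichotomy i j with hij | hij | hij
  · exact absurd h (key i j hij)
  · exact hij
  · exact absurd h.symm (key j i hij)

/-! ### Rotating the cluster to the three vertices. -/

/-- The primitive third root of unity in the upper half plane. -/
noncomputable def ω : ℂ := ⟨-1 / 2, √3 / 2⟩

theorem ω_re : ω.re = -1 / 2 := rfl

theorem ω_im : ω.im = √3 / 2 := rfl

theorem sqrt_three_sq : √3 ^ 2 = (3 : ℝ) := Real.sq_sqrt (by norm_num)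

theorem norm_ω : ‖ω‖ = 1 := by
  have h : ‖ω‖ ^ 2 = 1 := by
    rw [norm_sq_eq, ω_re, ω_im]
    linear_combination sqrt_three_sq / 4
  exact (pow_eq_one_iff_of_nonneg (norm_nonneg _) two_ne_zero).1 h

theorem one_add_ω_add_sq : 1 + ω + ω ^ 2 = 0 := by
  apply Complex.ext
  · simp only [Complex.add_re, Complex.one_re, pow_two, Complex.mul_re, ω_re, ω_im, Complex.zero_re]
    linear_combination -sqrt_three_sq / 4
  · simp only [Complex.add_im, Complex.one_im, pow_two, Complex.mul_im, ω_re, ω_im, Complex.zero_im]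
    ring

theorem ω_pow_three : ω ^ 3 = 1 := by linear_combination (ω - 1) * one_add_ω_add_sq

/-- One of the vertices of a unit equilateral triangle centred at the origin. -/
noncomputable def shift : ℂ := ⟨-1 / 2, -(√3 / 6)⟩

/-- Makes `place (k + 1) 0 = place k 1`, so cluster `k + 1` lies on the unit circle about vertex
`k`. -/
theorem ω_mul_shift : ω * shift = shift + 1 := by
  apply Complex.ext
  · simp only [Complex.mul_re, ω_re, ω_im, shift, Complex.add_re, Complex.one_re]
    linear_combination sqrt_three_sq / 12
  · simp only [Complex.mul_im, ω_re, ω_im, shift, Complex.add_im, Complex.one_im]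
    ring

/-- The point `z` seen from the vertex `shift` and rotated `k` times by a third of a turn; the
images of `1` are the vertices of the triangle. -/
noncomputable def place (k : ℕ) (z : ℂ) : ℂ := ω ^ k * (z + shift)

theorem place_add_three (k : ℕ) (z : ℂ) : place (k + 3) z = place k z := by
  rw [place, place, pow_add, ω_pow_three, mul_one]

theorem norm_ω_pow_mul (k : ℕ) (z : ℂ) : ‖ω ^ k * z‖ = ‖z‖ := by
  rw [norm_mul, norm_pow, norm_ω, one_pow, one_mul]

theorem dist_place (k : ℕ) (z w : ℂ) : dist (place k z) (place k w) = dist z w := by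
  rw [dist_eq_norm, dist_eq_norm, ← norm_ω_pow_mul k (z - w), place, place]
  congr 1
  ring

theorem dist_place_succ (k : ℕ) (z w : ℂ) :
    dist (place k z) (place (k + 1) w) = ‖z - 1 - ω * w‖ := by
  rw [dist_eq_norm, ← norm_ω_pow_mul k (z - 1 - ω * w), place, place]
  congr 1
  linear_combination (-ω ^ k) * ω_mul_shift

theorem dist_place_succ_one (k : ℕ) (z : ℂ) : dist (place (k + 1) z) (place k 1) = ‖z‖ := by
  rw [dist_comm, dist_place_succ, sub_self, zero_sub, norm_neg, ← pow_one ω, norm_ω_pow_mul]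

/-- Raising the first point by `y` shortens the distance to first order in `y`, whereas its
horizontal defect is at most `y ^ 2`. -/
theorem dist_place_arcPoint_succ_le (k i j : ℕ) :
    dist (place k (arcPoint i)) (place (k + 1) (arcPoint j)) ≤ 1 := by
  rw [dist_place_succ]
  refine (abs_le_of_sq_le_sq' ?_ zero_le_one).2
  rw [norm_sq_eq]
  simp only [Complex.sub_re, Complex.sub_im, Complex.mul_re, Complex.mul_im, Complex.one_re,
    Complex.one_im, ω_re, ω_im]
  obtain ⟨hv, hv'⟩ := height_pos_and_le j
  obtain ⟨hy, hy'⟩ := height_pos_and_le i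
  have hx₁ := arcPoint_re_le_one i
  have hx₂ := one_sub_arcPoint_re_le i
  have hx₃ := arcPoint_re_sq i
  have hu₁ := arcPoint_re_le_one j
  have hu₂ := one_sub_arcPoint_re_le j
  have hu₃ := arcPoint_re_sq j
  change (_ - _ - (_ - _ * height j)) ^ 2 + (height i - 0 - (_ * height j + _)) ^ 2 ≤ 1 ^ 2
  generalize (arcPoint i).re = x at *
  generalize (arcPoint j).re = u at *
  generalize height i = y at *
  generalize height j = v at *
  have hτ := sqrt_three_sq
  have hτ₀ : 1 ≤ √3 := by rw [Real.one_le_sqrt]; norm_num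
  have hτ₂ : √3 ≤ 2 := by nlinarith
  generalize √3 = τ at *
  have e : (x - 1 - (-1 / 2 * u - τ / 2 * v)) ^ 2 + (y - 0 - (-1 / 2 * v + τ / 2 * u)) ^ 2
      = 1 + 2 * ((1 - x) * (1 - u / 2 - τ / 2 * v) - y * (τ / 2 * u - v / 2)) := by
    linear_combination hx₃ + (1 / 4 + 3 / 4) * hu₃ + (v ^ 2 + u ^ 2) / 4 * hτ
  have h₁ : u ≥ 9 / 10 := by nlinarith
  have h₂ : (1 - x) * (1 - u / 2 - τ / 2 * v) ≤ (1 - x) * 1 :=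
    mul_le_mul_of_nonneg_left (by nlinarith) (by linarith)
  have h₃ : y * (1 / 4) ≤ y * (τ / 2 * u - v / 2) :=
    mul_le_mul_of_nonneg_left (by nlinarith) hy.le
  rw [e]
  nlinarith

theorem place_arcPoint_succ_ne (k i j : ℕ) :
    place k (arcPoint i) ≠ place (k + 1) (arcPoint j) := by
  intro h
  have h₁ := dist_place_succ_one k (arcPoint j)
  rw [← h, dist_place, norm_arcPoint] at h₁
  have h₂ := dist_arcPoint_one_le i
  have h₃ := (height_pos_and_le i).2
  linarith

/-! ### Counting the points in a disc of radius `1 / 2`. -/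

theorem le_of_mem_closedBall {o : ℂ} {k i j l : ℕ} (hij : i < j)
    (hi : dist (place (k + 1) (arcPoint i)) o ≤ 1 / 2)
    (hj : dist (place (k + 1) (arcPoint j)) o ≤ 1 / 2)
    (hl : dist (place k (arcPoint l)) o ≤ 1 / 2) : l ≤ i := by
  by_contra! hil
  have h := dist_sq_le_of_mem_closedBall hi hj hl
    ((dist_place_succ_one k _).trans (norm_arcPoint i))
    ((dist_place_succ_one k _).trans (norm_arcPoint j))
  rw [dist_place, dist_place] at h
  linarith [dist_arcPoint_sq_gt hij hil, dist_arcPoint_one_le l]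

/-- Turn the three vectors from `o` back to one frame: `o` cancels because `1 + ω + ω ^ 2 = 0`.
Their sum has norm at most `3 / 2`, yet is close to `3 * (1 + shift)`, of norm `√3`. -/
theorem not_meets_three {o : ℂ} {i j l : ℕ} (hi : dist (place 0 (arcPoint i)) o ≤ 1 / 2)
    (hj : dist (place 1 (arcPoint j)) o ≤ 1 / 2) (hl : dist (place 2 (arcPoint l)) o ≤ 1 / 2) :
    False := by
  have e : arcPoint i + arcPoint j + arcPoint l + 3 * shift
      = (place 0 (arcPoint i) - o) + ω ^ 2 * (place 1 (arcPoint j) - o)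
        + ω ^ 1 * (place 2 (arcPoint l) - o) := by
    simp only [place]
    linear_combination o * one_add_ω_add_sq
      - (arcPoint j + shift + arcPoint l + shift) * ω_pow_three
  have h : ‖arcPoint i + arcPoint j + arcPoint l + 3 * shift‖ ≤ 3 / 2 := by
    rw [e]
    refine (norm_add₃_le).trans ?_
    rw [norm_ω_pow_mul, norm_ω_pow_mul, ← dist_eq_norm, ← dist_eq_norm, ← dist_eq_norm]
    linarith
  have h' : ‖arcPoint i + arcPoint j + arcPoint l + 3 * shift‖ ^ 2 ≤ (3 / 2) ^ 2 := by gcongr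
  have three : (3 : ℂ) = ((3 : ℝ) : ℂ) := by norm_num
  rw [norm_sq_eq, three] at h'
  simp only [Complex.add_re, Complex.add_im, Complex.re_ofReal_mul, Complex.im_ofReal_mul,
    shift] at h'
  have hre : ∀ i, 99 / 100 ≤ (arcPoint i).re := fun i => by
    nlinarith [one_sub_arcPoint_re_le i, (height_pos_and_le i).1, (height_pos_and_le i).2]
  have him : ∀ i, (arcPoint i).im ≤ 1 / 100 := fun i => (height_pos_and_le i).2
  have hτ : 17 / 10 ≤ √3 := Real.le_sqrt_of_sq_le (by norm_num)
  nlinarith [hre i, hre j, hre l, him i, him j, him l]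

/-- If `T` has two elements, `U` lies weakly below `min T` and `T` weakly above; the shared index
gives the `+ 1`. -/
theorem card_add_card_le {m : ℕ} {T U : Finset ℕ} (hT : T ⊆ Finset.range m)
    (hU : U ⊆ Finset.range m) (h : ∀ i ∈ T, ∀ j ∈ T, i < j → ∀ l ∈ U, l ≤ i) :
    T.card + U.card ≤ m + 1 := by
  have hU' : U.card ≤ m := by simpa using Finset.card_le_card hU
  rcases Nat.lt_or_ge 1 T.card with hc | hc
  · have hne : T.Nonempty := Finset.card_pos.1 (by omega)
    obtain ⟨j, hj, hjne⟩ := Finset.exists_mem_ne hc (T.min' hne)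
    have hlt : T.min' hne < j := lt_of_le_of_ne (T.min'_le j hj) hjne.symm
    have hUc : U.card ≤ T.min' hne + 1 := by
      have : U ⊆ Finset.range (T.min' hne + 1) := fun l hl =>
        Finset.mem_range.2 (Nat.lt_succ_of_le (h _ (T.min'_mem hne) j hj hlt l hl))
      simpa using Finset.card_le_card this
    have hTc : T.card ≤ m - T.min' hne := by
      have : T ⊆ Finset.Ico (T.min' hne) m := fun i hi =>
        Finset.mem_Ico.2 ⟨T.min'_le i hi, Finset.mem_range.1 (hT hi)⟩
      simpa using Finset.card_le_card this
    have := Finset.mem_range.1 (hT hj)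
    omega
  · omega

theorem card_filter_le (m : ℕ) (o : ℂ) :
    (((Finset.range 3 ×ˢ Finset.range m).filter
      fun q => dist (place q.1 (arcPoint q.2)) o ≤ 1 / 2).card) ≤ m + 1 := by
  classical
  let T : ℕ → Finset ℕ := fun k =>
    (Finset.range m).filter fun i => dist (place k (arcPoint i)) o ≤ 1 / 2
  have hT : ∀ k i, i ∈ T k → dist (place k (arcPoint i)) o ≤ 1 / 2 := fun k i hi =>
    (Finset.mem_filter.1 hi).2
  have hT3 : T 3 = T 0 := by
    simp only [T, ← place_add_three 0, zero_add]
  have hpair : ∀ k, (T (k + 1)).card + (T k).card ≤ m + 1 := fun k =>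
    card_add_card_le (Finset.filter_subset _ _) (Finset.filter_subset _ _)
      fun i hi j hj hij l hl =>
        le_of_mem_closedBall hij (hT _ _ hi) (hT _ _ hj) (hT _ _ hl)
  have hsum : (((Finset.range 3 ×ˢ Finset.range m).filter
      fun q => dist (place q.1 (arcPoint q.2)) o ≤ 1 / 2).card)
      = (T 0).card + (T 1).card + (T 2).card := by
    rw [Finset.card_filter, Finset.sum_product]
    simp only [Finset.sum_range_succ (n := 2), Finset.sum_range_succ (n := 1),
      Finset.sum_range_succ (n := 0), Finset.sum_range_zero, zero_add, T, Finset.card_filter]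
  rw [hsum]
  have h₀ := hpair 0
  have h₁ := hpair 1
  have h₂ := hpair 2
  simp only [zero_add, Nat.reduceAdd] at h₀ h₁ h₂
  rw [hT3] at h₂
  rcases (T 0).eq_empty_or_nonempty with h | ⟨i, hi⟩
  · rw [h, Finset.card_empty]; omega
  rcases (T 1).eq_empty_or_nonempty with h | ⟨j, hj⟩
  · rw [h, Finset.card_empty]; omega
  rcases (T 2).eq_empty_or_nonempty with h | ⟨l, hl⟩
  · rw [h, Finset.card_empty]; omega
  exact (not_meets_three (hT _ _ hi) (hT _ _ hj) (hT _ _ hl)).elim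

/-! ### The extremal configuration in the plane. -/

/-- The points of three clusters near the vertices of a unit equilateral triangle, in the plane. -/
noncomputable def clusterPoint (q : ℕ × ℕ) : Plane :=
  Complex.orthonormalBasisOneI.repr (place q.1 (arcPoint q.2))

theorem dist_clusterPoint (q : ℕ × ℕ) (c : Plane) :
    dist (clusterPoint q) c
      = dist (place q.1 (arcPoint q.2)) (Complex.orthonormalBasisOneI.repr.symm c) := by
  rw [← Complex.orthonormalBasisOneI.repr.dist_map, LinearIsometryEquiv.apply_symm_apply,
    clusterPoint]

theorem eq_or_cyclic {k l : ℕ} (hk : k < 3) (hl : l < 3) :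
    k = l ∨ l = k + 1 ∨ k = l + 1 ∨ (k = 0 ∧ l = 2) ∨ (k = 2 ∧ l = 0) := by omega

theorem dist_place_arcPoint_le {k l : ℕ} (hk : k < 3) (hl : l < 3) (i j : ℕ) :
    dist (place k (arcPoint i)) (place l (arcPoint j)) ≤ 1 := by
  rcases eq_or_cyclic hk hl with rfl | rfl | rfl | ⟨rfl, rfl⟩ | ⟨rfl, rfl⟩
  · rw [dist_place]
    have := dist_triangle_right (arcPoint i) (arcPoint j) 1
    linarith [dist_arcPoint_one_le i, dist_arcPoint_one_le j, (height_pos_and_le i).2,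
      (height_pos_and_le j).2]
  · exact dist_place_arcPoint_succ_le _ _ _
  · rw [dist_comm]; exact dist_place_arcPoint_succ_le _ _ _
  · rw [dist_comm, ← place_add_three 0]; exact dist_place_arcPoint_succ_le _ _ _
  · rw [← place_add_three 0]; exact dist_place_arcPoint_succ_le _ _ _

theorem injOn_clusterPoint (m : ℕ) :
    Set.InjOn clusterPoint (Finset.range 3 ×ˢ Finset.range m : Finset (ℕ × ℕ)) := by
  rintro ⟨k, i⟩ hki ⟨l, j⟩ hlj h
  have hk : k < 3 := by simpa using (Finset.mem_product.1 (Finset.mem_coe.1 hki)).1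
  have hl : l < 3 := by simpa using (Finset.mem_product.1 (Finset.mem_coe.1 hlj)).1
  have h' : place k (arcPoint i) = place l (arcPoint j) :=
    Complex.orthonormalBasisOneI.repr.injective h
  rcases eq_or_cyclic hk hl with rfl | rfl | rfl | ⟨rfl, rfl⟩ | ⟨rfl, rfl⟩
  · have hd := dist_place k (arcPoint i) (arcPoint j)
    rw [h', dist_self] at hd
    rw [arcPoint_injective (dist_eq_zero.1 hd.symm)]
  · exact absurd h' (place_arcPoint_succ_ne _ _ _)
  · exact absurd h'.symm (place_arcPoint_succ_ne _ _ _)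
  · rw [← place_add_three 0] at h'
    exact absurd h'.symm (place_arcPoint_succ_ne _ _ _)
  · rw [← place_add_three 0] at h'
    exact absurd h' (place_arcPoint_succ_ne _ _ _)

theorem exists_pointSet_ncard_le {n m : ℕ} (hnm : n ≤ 3 * m) :
    ∃ P ∈ pointSets n, ∀ c : Plane,
      ((P : Set Plane) ∩ Metric.closedBall c (1 / 2)).ncard ≤ m + 1 := by
  classical
  obtain ⟨S, hS, hcard⟩ := Finset.exists_subset_card_eq
    (s := Finset.range 3 ×ˢ Finset.range m) (n := n) (by simpa using hnm)
  refine ⟨S.image clusterPoint, ⟨?_, ?_⟩, fun c => ?_⟩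
  · rw [Finset.card_image_of_injOn ((injOn_clusterPoint m).mono (Finset.coe_subset.2 hS)), hcard]
  · intro x hx y hy
    obtain ⟨p, hp, rfl⟩ := Finset.mem_image.1 hx
    obtain ⟨q, hq, rfl⟩ := Finset.mem_image.1 hy
    rw [clusterPoint, clusterPoint, LinearIsometryEquiv.dist_map]
    exact dist_place_arcPoint_le (Finset.mem_range.1 (Finset.mem_product.1 (hS hp)).1)
      (Finset.mem_range.1 (Finset.mem_product.1 (hS hq)).1) _ _
  · let o := Complex.orthonormalBasisOneI.repr.symm c
    refine le_trans ?_ (card_filter_le m o)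
    have hsub : ((S.image clusterPoint : Finset Plane) : Set Plane) ∩ Metric.closedBall c (1 / 2)
        ⊆ ((((Finset.range 3 ×ˢ Finset.range m).filter
          fun q => dist (place q.1 (arcPoint q.2)) o ≤ 1 / 2).image clusterPoint : Finset Plane) :
            Set Plane) := by
      rintro x ⟨hx, hxc⟩
      obtain ⟨q, hq, rfl⟩ := Finset.mem_image.1 (Finset.mem_coe.1 hx)
      refine Finset.mem_coe.2 (Finset.mem_image_of_mem _ (Finset.mem_filter.2 ⟨hS hq, ?_⟩))
      rwa [Metric.mem_closedBall, dist_clusterPoint] at hxc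
    refine (Set.ncard_le_ncard hsub (Finset.finite_toSet _)).trans ?_
    rw [Set.ncard_coe_finset]
    exact Finset.card_image_le

end FractionalJung

theorem corollary1 (n : ℕ) (hn : 1 ≤ n) :
    ⌈(n : ℝ) / 3⌉₊ ≤ FractionalJung.N n (1 / 2) ∧
      FractionalJung.N n (1 / 2) ≤ ⌈(n : ℝ) / 3⌉₊ + 1 := by
  have hN := FractionalJung.isGreatest_N n (1 / 2)
  refine ⟨hN.2 (FractionalJung.ceil_third_mem_guaranteed n), ?_⟩
  have hnm : n ≤ 3 * ⌈(n : ℝ) / 3⌉₊ := by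
    have h := Nat.le_ceil ((n : ℝ) / 3)
    have h' : (n : ℝ) ≤ 3 * (⌈(n : ℝ) / 3⌉₊ : ℝ) := by linarith
    exact_mod_cast h'
  obtain ⟨P, hP, hPc⟩ := FractionalJung.exists_pointSet_ncard_le hnm
  obtain ⟨c, hc⟩ := hN.1 P hP
  exact hc.trans (hPc c)
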